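/- Let $G$ be a countable discrete group with identity $e$ and let $G\curvearrowright X$ be a free continuous action on a compact metrizable space $X$, equipped with any compatible metric. Suppose that $X$ is zero-dimensional, i.e., has covering dimension $0$. Then the tower dimension, fine tower dimension, dynamic asymptotic dimension and amenability dimension of the action coincide: $$\mathrm{dim}_{\mathrm{tow}}(X,G)=\mathrm{dim}_{\mathrm{ftow}}(X,G)=\mathrm{dad}(X,G)=\mathrm{dim}_{\mathrm{am}}(X,G)\in\{0,1,2,\dots\}\cup\{\infty\}.$$ Here each dimension is the least integer $d\ge 0$ with the property stated below, and is $\infty$ if there is no such $d$. A tower is a pair $(V,S)$ with $V\subseteq X$ and $S\subseteq G$ finite such that the levels $sV$, $s\in S$, are pairwise disjoint; it is open if $V$ is open. A collection of towers $\{(V_i,S_i)\}_{i\in I}$ covers $X$ if $\bigcup_i S_iV_i=X$. For a finite set $E\subseteq G$, such a collection is $E$-Lebesgue if for every $x\in X$ there are $i\in I$ and $t\in S_i$ with $x\in tV_i$ and $Et\subseteq S_i$. A family $\{A_i\}_{i\in I}$ of sets has chromatic number at most $n$ if $I$ can be partitioned into $n$ (possibly empty) subsets such that, within each of them, the sets $A_i$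 are pairwise disjoint. - $\mathrm{dim}_{\mathrm{tow}}(X,G)$: for every finite $E\subseteq G$ there is an $E$-Lebesgue collection of open towers $\{(V_i,S_i)\}_{i\in I}$ covering $X$ such that $\{S_iV_i\}_{i\in I}$ has chromatic number at most $d+1$. - $\mathrm{dim}_{\mathrm{ftow}}(X,G)$: for every finite $E\subseteq G$ and $\delta>0$ there is a collection as for $\mathrm{dim}_{\mathrm{tow}}$ for which, in addition, $\mathrm{diam}(sV_i)<\delta$ for all $i\in I$ and $s\in S_i$. - $\mathrm{dad}(X,G)$: for every finite $E\subseteq G$ there are a finite set $F\subseteq G$ and an open cover $\{U_0,\dots,U_d\}$ of $X$ such that, for all $x\in X$ and $s_1,\dots,s_n\in E$, if the points $x,\,s_1x,\,s_2s_1x,\,\dots,\,s_n\cdots s_1x$ all lie in a common $U_j$ then $s_n\cdots s_1\in F$. - $\mathrm{dim}_{\mathrm{am}}(X,G)$: for every finite $F\subseteq G$ and $\varepsilon>0$ there is a continuous map $\varphi:X\to\Delta_d(G)$ with $\sup_{x\in X}\|\varphi(sx)-s\varphi(x)\|_1<\varepsilon$ for all $s\in F$, where $\Delta_d(G)\subseteq\ell^1(G)$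 is the set of probability measures on $G$ whose support has at most $d+1$ elements, with the $\ell^1$-norm topology, and $(s\mu)(t)=\mu(s^{-1}t)$. -/

import Mathlib

open scoped Pointwise ENNReal

noncomputable section

namespace GroupAction

/-! ### Covering dimension -/

/-- The covering dimension of `X` is at most `n`: every finite open cover of `X` has a finite open
refinement covering `X` such that every point lies in at most `n + 1` of its members. -/
def CoveringDimLE (X : Type*) [TopologicalSpace X] (n : ℕ) : Prop :=
  ∀ 𝒰 : Set (Set X), 𝒰.Finite → (∀ U ∈ 𝒰, IsOpen U) → ⋃₀ 𝒰 = Set.univ →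
    ∃ 𝒱 : Set (Set X), 𝒱.Finite ∧ (∀ V ∈ 𝒱, IsOpen V) ∧ ⋃₀ 𝒱 = Set.univ ∧
      (∀ V ∈ 𝒱, ∃ U ∈ 𝒰, V ⊆ U) ∧ ∀ x : X, {V ∈ 𝒱 | x ∈ V}.encard ≤ n + 1

/-- `X` is zero-dimensional: its covering dimension is at most `0` (the empty space, of
dimension `-1`, is harmlessly included). -/
def IsZeroDimensional (X : Type*) [TopologicalSpace X] : Prop := CoveringDimLE X 0

/-- The least natural number satisfying `P`, and `∞` if there is none. -/
def leastNat (P : ℕ → Prop) : ℕ∞ := ⨅ (d : ℕ) (_ : P d), (d : ℕ∞)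

/-- An indexed family of subsets has chromatic number at most `n`: the index set splits into `n`
(possibly empty) parts such that the members of the family in each part are pairwise disjoint. -/
def ChromaticNumberLE {ι X : Type*} (A : ι → Set X) (n : ℕ) : Prop :=
  ∃ c : ι → Fin n, ∀ i j, i ≠ j → c i = c j → Disjoint (A i) (A j)

/-! ### Towers -/

section Towers

variable (G X : Type*) [Group G] [MulAction G X]

/-- A tower `(V, S)`: a set `V ⊆ X` and a finite set `S ⊆ G` such that the levels `s V`, `s ∈ S`,
are pairwise disjoint. -/
structure Tower where
  base : Set X
  shape : Finset G
  disjoint_levels : (shape : Set G).PairwiseDisjoint fun s => s • base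

variable {G X}

/-- The union `S V` of the levels of a tower `(V, S)`. -/
def Tower.carrier (T : Tower G X) : Set X := ⋃ s ∈ T.shape, s • T.base

/-- The towers of the collection cover `X`. -/
def TowersCover (𝒯 : Set (Tower G X)) : Prop := ⋃ T ∈ 𝒯, T.carrier = Set.univ

/-- A collection of towers is `E`-Lebesgue if for every `x` there are a tower `(V, S)` in it and a
`t ∈ S` with `x ∈ t V` and `E t ⊆ S`. -/
def TowersLebesgue (E : Finset G) (𝒯 : Set (Tower G X)) : Prop :=
  ∀ x : X, ∃ T ∈ 𝒯, ∃ t ∈ T.shape, x ∈ t • T.base ∧ ∀ s ∈ E, s * t ∈ T.shape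

end Towers

/-! ### The four dimensions -/

/-- The defining property of "tower dimension at most `d`". -/
def TowDimLE (G X : Type*) [Group G] [TopologicalSpace X] [MulAction G X] (d : ℕ) : Prop :=
  ∀ E : Finset G, ∃ 𝒯 : Set (Tower G X),
    (∀ T ∈ 𝒯, IsOpen T.base) ∧ TowersCover 𝒯 ∧ TowersLebesgue E 𝒯 ∧
      ChromaticNumberLE (fun T : 𝒯 => T.1.carrier) (d + 1)

/-- The tower dimension. -/
def towDim (G X : Type*) [Group G] [TopologicalSpace X] [MulAction G X] : ℕ∞ :=
  leastNat (TowDimLE G X)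

/-- The defining property of "fine tower dimension at most `d`". -/
def FineTowDimLE (G X : Type*) [Group G] [MetricSpace X] [MulAction G X] (d : ℕ) : Prop :=
  ∀ (E : Finset G) (δ : ℝ), 0 < δ → ∃ 𝒯 : Set (Tower G X),
    (∀ T ∈ 𝒯, IsOpen T.base) ∧ TowersCover 𝒯 ∧ TowersLebesgue E 𝒯 ∧
      (∀ T ∈ 𝒯, ∀ s ∈ T.shape, Metric.diam (s • T.base) < δ) ∧
      ChromaticNumberLE (fun T : 𝒯 => T.1.carrier) (d + 1)

/-- The fine tower dimension. -/
def fineTowDim (G X : Type*) [Group G] [MetricSpace X] [MulAction G X] : ℕ∞ :=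
  leastNat (FineTowDimLE G X)

/-- The defining property of "dynamic asymptotic dimension at most `d`". A word `s₁, …, sₙ` in `E`
is given as the list `l = [sₙ, …, s₁]`; the products of the suffixes of `l` are
`1, s₁, s₂ s₁, …, sₙ ⋯ s₁`. -/
def DadLE (G X : Type*) [Group G] [TopologicalSpace X] [MulAction G X] (d : ℕ) : Prop :=
  ∀ E : Finset G, ∃ (F : Finset G) (U : Fin (d + 1) → Set X),
    (∀ j, IsOpen (U j)) ∧ ⋃ j, U j = Set.univ ∧
      ∀ (x : X) (l : List G), (∀ s ∈ l, s ∈ E) →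
        ∀ j, (∀ m : List G, m <:+ l → m.prod • x ∈ U j) → l.prod ∈ F

/-- The dynamic asymptotic dimension. -/
def dynAsympDim (G X : Type*) [Group G] [TopologicalSpace X] [MulAction G X] : ℕ∞ :=
  leastNat (DadLE G X)

/-- The Banach space `ℓ¹(G)`. -/
abbrev EllOne (G : Type*) : Type _ := lp (fun _ : G => ℝ) 1

/-- The probability measures on `G` whose support has at most `d + 1` elements, inside `ℓ¹(G)`. -/
def probSimplex (G : Type*) (d : ℕ) : Set (EllOne G) :=
  {μ | (∀ t, 0 ≤ μ t) ∧ HasSum (fun t => μ t) 1 ∧ (Function.support fun t => μ t).encard ≤ d + 1}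

/-- The left translation action on `ℓ¹(G)`: `(s μ)(t) = μ (s⁻¹ t)`. -/
def leftTranslate {G : Type*} [Group G] (s : G) (μ : EllOne G) : EllOne G :=
  ⟨fun t => μ (s⁻¹ * t), by
    have h := (memℓp_gen_iff (p := 1) (by norm_num)).1 (lp.memℓp μ)
    exact memℓp_gen ((Equiv.mulLeft s⁻¹).summable_iff.2 h)⟩

/-- The defining property of "amenability dimension at most `d`" (by compactness of `X`, a strict
pointwise bound by `ε` is the same as `sup_x ‖φ(sx) - sφ(x)‖₁ < ε`). -/
def AmDimLE (G X : Type*) [Group G] [TopologicalSpace X] [MulAction G X] (d : ℕ) : Prop :=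
  ∀ (F : Finset G) (ε : ℝ), 0 < ε → ∃ φ : X → EllOne G, Continuous φ ∧
    (∀ x, φ x ∈ probSimplex G d) ∧
      ∀ s ∈ F, ∀ x, ‖φ (s • x) - leftTranslate s (φ x)‖ < ε

/-- The amenability dimension. -/
def amDim (G X : Type*) [Group G] [TopologicalSpace X] [MulAction G X] : ℕ∞ :=
  leastNat (AmDimLE G X)

end GroupAction

end

open scoped Topology

namespace GroupAction

theorem leastNat_congr {P Q : ℕ → Prop} (h : ∀ d, P d ↔ Q d) : leastNat P = leastNat Q := by
  unfold leastNat
  exact iInf_congr fun d => iInf_congr_Prop (h d) fun _ => rfl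

section ZeroDimensional

variable {X : Type*} [TopologicalSpace X]

theorem IsZeroDimensional.exists_isClopen [T1Space X] (hX : IsZeroDimensional X) {x : X}
    {O : Set X} (hO : IsOpen O) (hx : x ∈ O) : ∃ V, IsClopen V ∧ x ∈ V ∧ V ⊆ O := by
  obtain ⟨𝒱, -, hopen, hcover, href, hone⟩ := hX {O, {x}ᶜ} (by simp)
    (by rintro U (rfl | rfl); exacts [hO, isOpen_compl_singleton])
    (by
      ext y
      by_cases hy : y = x
      · simp [hy, hx]
      · simp [hy])
  obtain ⟨V, hV, hxV⟩ : x ∈ ⋃₀ 𝒱 := hcover ▸ Set.mem_univ x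
  refine ⟨V, ⟨⟨?_⟩, hopen V hV⟩, hxV, ?_⟩
  · have : Vᶜ = ⋃₀ (𝒱 \ {V}) := by
      ext y
      constructor
      · intro hy
        obtain ⟨V', hV', hyV'⟩ : y ∈ ⋃₀ 𝒱 := hcover ▸ Set.mem_univ y
        exact ⟨V', ⟨hV', fun h => hy (h ▸ hyV')⟩, hyV'⟩
      · rintro ⟨V', ⟨hV', hne⟩, hyV'⟩ hy
        refine hne ?_
        have h1 := hone y
        simp only [Nat.cast_zero, zero_add] at h1
        exact Set.encard_le_one_iff.1 h1 V' V ⟨hV', hyV'⟩ ⟨hV, hy⟩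
    rw [this]
    exact isOpen_sUnion fun V' hV' => hopen V' hV'.1
  · obtain ⟨U, hU, hVU⟩ := href V hV
    rcases hU with rfl | rfl
    · exact hVU
    · exact absurd rfl (hVU hxV)

theorem IsZeroDimensional.exists_clopen_shrinking [T1Space X] [CompactSpace X]
    (hX : IsZeroDimensional X) {ι : Type*} (U : ι → Set X) (hU : ∀ i, IsOpen (U i))
    (hcover : ∀ x, ∃ i, x ∈ U i) :
    ∃ W : ι → Set X, (∀ i, IsClopen (W i)) ∧ (∀ i, W i ⊆ U i) ∧ (∀ x, ∃ i, x ∈ W i) ∧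
      {i | (W i).Nonempty}.Finite := by
  choose i hi using hcover
  choose V hV hxV hVU using fun x => hX.exists_isClopen (hU (i x)) (hi x)
  obtain ⟨b, hb⟩ := isCompact_univ.elim_finite_subcover V (fun x => (hV x).2)
    fun x _ => Set.mem_iUnion.2 ⟨x, hxV x⟩
  classical
  refine ⟨fun k => ⋃ x ∈ b.filter fun x => i x = k, V x, ?_, ?_, ?_, ?_⟩
  · exact fun k => (b.filter _).finite_toSet.isClopen_biUnion fun x _ => hV x
  · intro k
    simp only [Set.iUnion_subset_iff, Finset.mem_filter]
    rintro x ⟨-, rfl⟩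
    exact hVU x
  · intro y
    obtain ⟨x, hx, hy⟩ := Set.mem_iUnion₂.1 (hb (Set.mem_univ y))
    exact ⟨i x, Set.mem_iUnion₂.2 ⟨x, by simp [hx], hy⟩⟩
  · refine (b.finite_toSet.image i).subset ?_
    rintro k ⟨y, hy⟩
    obtain ⟨x, hx, -⟩ := Set.mem_iUnion₂.1 hy
    rw [Finset.mem_filter] at hx
    exact ⟨x, hx.1, hx.2⟩

end ZeroDimensional

section AsymptoticToFineTower

variable {G X : Type*} [Group G] [MulAction G X]

/-- `Reach E Y x g`: a word in `E` with product `g` leads from `x` to `g • x` inside `Y`. -/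
inductive Reach (E : Finset G) (Y : Set X) (x : X) : G → Prop
  | one : x ∈ Y → Reach E Y x 1
  | mul {s g : G} : s ∈ E → Reach E Y x g → (s * g) • x ∈ Y → Reach E Y x (s * g)

namespace Reach

variable {E : Finset G} {Y : Set X} {x : X} {g h : G}

theorem smul_mem (hg : Reach E Y x g) : g • x ∈ Y := by
  cases hg with
  | one hx => rwa [one_smul]
  | mul _ _ hx => exact hx

theorem mem (hg : Reach E Y x g) : x ∈ Y := by
  induction hg with
  | one hx => exact hx
  | mul _ _ _ ih => exact ih

theorem trans (hg : Reach E Y x g) (hh : Reach E Y (g • x) h) : Reach E Y x (h * g) := by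
  induction hh with
  | one => rwa [one_mul]
  | mul hs _ hx ih =>
    rw [mul_assoc]
    rw [smul_smul, mul_assoc] at hx
    exact mul hs ih hx

theorem symm (hE : ∀ s ∈ E, s⁻¹ ∈ E) (hg : Reach E Y x g) : Reach E Y (g • x) g⁻¹ := by
  induction hg with
  | one hx => simpa using one hx
  | @mul s g hs hg hx ih =>
    have h1 : Reach E Y ((s * g) • x) (s⁻¹ * 1) := mul (hE s hs) (one hx) (by
      rw [mul_one, smul_smul, inv_mul_cancel_left]
      exact hg.smul_mem)
    rw [mul_one] at h1
    have h2 : s⁻¹ • (s * g) • x = g • x := by rw [smul_smul, inv_mul_cancel_left]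
    rw [mul_inv_rev]
    exact h1.trans (h2 ▸ ih)

theorem exists_list (hg : Reach E Y x g) :
    ∃ l : List G, (∀ s ∈ l, s ∈ E) ∧ l.prod = g ∧ ∀ m : List G, m <:+ l → m.prod • x ∈ Y := by
  induction hg with
  | one hx => exact ⟨[], by simp, rfl, by simpa using hx⟩
  | @mul s g hs hg hx ih =>
    obtain ⟨l, hl, rfl, hm⟩ := ih
    refine ⟨s :: l, by simpa using ⟨hs, hl⟩, List.prod_cons, fun m hml => ?_⟩
    rcases List.suffix_cons_iff.1 hml with rfl | hml
    · simpa using hx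
    · exact hm m hml

/-- Words in `E` staying in `⋃ e ∈ E, e • W` are shadowed by words in `E⁻¹ * E * E` staying in
`W`. -/
theorem exists_shadow [DecidableEq G] {W : Set X} (hg : Reach E (⋃ e ∈ E, e • W) x g) :
    ∃ a ∈ E, ∃ b ∈ E, Reach (E⁻¹ * E * E) W (a⁻¹ • x) (b⁻¹ * g * a) := by
  induction hg with
  | one hx =>
    obtain ⟨a, ha, hx⟩ := Set.mem_iUnion₂.1 hx
    rw [Set.mem_smul_set_iff_inv_smul_mem] at hx
    exact ⟨a, ha, a, ha, by simpa using one hx⟩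
  | @mul s g hs hg hx ih =>
    obtain ⟨a, ha, b, hb, hr⟩ := ih
    obtain ⟨c, hc, hx⟩ := Set.mem_iUnion₂.1 hx
    rw [Set.mem_smul_set_iff_inv_smul_mem] at hx
    have h := hr.mul (s := c⁻¹ * s * b)
      (Finset.mul_mem_mul (Finset.mul_mem_mul (Finset.inv_mem_inv hc) hs) hb) (by
        rw [smul_smul] at hx ⊢
        convert hx using 2
        group)
    refine ⟨a, ha, c, hc, ?_⟩
    convert h using 1
    group

theorem finite_of_shadow {W : Set X} {F : Finset G} [DecidableEq G]
    (hF : ∀ y g, Reach (E⁻¹ * E * E) W y g → g ∈ F) :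
    {g | Reach E (⋃ e ∈ E, e • W) x g}.Finite := by
  refine (E * F * E⁻¹).finite_toSet.subset fun g hg => ?_
  obtain ⟨a, ha, b, hb, hr⟩ := exists_shadow hg
  have : g = b * (b⁻¹ * g * a) * a⁻¹ := by group
  rw [Finset.mem_coe, this]
  exact Finset.mul_mem_mul (Finset.mul_mem_mul hb (hF _ _ hr)) (Finset.inv_mem_inv ha)

end Reach

section LocallyConstant

variable [TopologicalSpace X] [ContinuousConstSMul G X] {E : Finset G} {Y : Set X}

theorem Reach.eventually (hY : IsOpen Y) {x : X} {g : G} (hg : Reach E Y x g) :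
    ∀ᶠ y in 𝓝 x, Reach E Y y g := by
  induction hg with
  | one hx =>
    filter_upwards [hY.mem_nhds hx] with y hy
    exact .one hy
  | @mul s g hs hg hx ih =>
    filter_upwards [ih, (continuous_const_smul (s * g)).continuousAt (hY.mem_nhds hx)] with y h1 h2
    exact h1.mul hs h2

theorem eventually_reach_iff (hY : IsClopen Y) {x : X} (hx : x ∈ Y)
    (hfin : {g | Reach E Y x g}.Finite) : ∀ᶠ y in 𝓝 x, ∀ g, Reach E Y y g ↔ Reach E Y x g := by
  have h1 : ∀ᶠ y in 𝓝 x, ∀ g ∈ {g | Reach E Y x g}, Reach E Y y g :=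
    (Filter.eventually_all_finite hfin).2 fun g hg => hg.eventually hY.isOpen
  have h2 : ∀ᶠ y in 𝓝 x, ∀ g ∈ {g | Reach E Y x g}, ∀ s ∈ E,
      (s * g) • y ∈ Y → (s * g) • x ∈ Y := by
    refine (Filter.eventually_all_finite hfin).2 fun g _ =>
      (Filter.eventually_all_finset E).2 fun s _ => ?_
    by_cases h : (s * g) • x ∈ Y
    · exact Filter.Eventually.of_forall fun _ _ => h
    · filter_upwards [(continuous_const_smul (s * g)).continuousAt
        (hY.compl.isOpen.mem_nhds h)] with y hy hy'
      exact absurd hy' hy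
  filter_upwards [h1, h2] with y h1 h2 g
  refine ⟨fun hg => ?_, h1 g⟩
  induction hg with
  | one => exact .one hx
  | mul hs _ hy ih => exact ih.mul hs (h2 _ ih _ hs hy)

end LocallyConstant

theorem exists_forall_two_mul_lt_dist [MetricSpace X]
    (hfree : ∀ (g : G) (x : X), g • x = x → g = 1) (S : Finset G) (x : X) {δ : ℝ} (hδ : 0 < δ) :
    ∃ r > 0, r < δ ∧ ∀ s ∈ S, ∀ t ∈ S, s ≠ t → 2 * r < dist (s • x) (t • x) := by
  have h : ∀ᶠ r in 𝓝[>] (0 : ℝ), r < δ ∧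
      ∀ s ∈ S, ∀ t ∈ S, s ≠ t → 2 * r < dist (s • x) (t • x) := by
    refine ((eventually_lt_nhds hδ).filter_mono nhdsWithin_le_nhds).and
      ((Filter.eventually_all_finset S).2 fun s _ => (Filter.eventually_all_finset S).2 fun t _ => ?_)
    by_cases hst : s = t
    · exact Filter.Eventually.of_forall fun _ h => absurd hst h
    · have hpos : 0 < dist (s • x) (t • x) / 2 := by
        refine half_pos (dist_pos.2 fun h => hst ?_)
        have := hfree (t⁻¹ * s) x (by rw [mul_smul, h, inv_smul_smul])
        rw [inv_mul_eq_one] at this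
        exact this.symm
      filter_upwards [(eventually_lt_nhds hpos).filter_mono nhdsWithin_le_nhds] with r hr _
      linarith
  obtain ⟨r, hr, hr0⟩ := (h.and self_mem_nhdsWithin).exists
  exact ⟨r, hr0, hr⟩

section Castle

variable [MetricSpace X]

/-- Around every point of `Y` there is a clopen tower base of small levels whose shape describes
the `Reach`-class of each of its points. -/
theorem exists_reach_base [ContinuousConstSMul G X] (hX : IsZeroDimensional X)
    (hfree : ∀ (g : G) (x : X), g • x = x → g = 1) {E : Finset G} {Y : Set X} (hY : IsClopen Y)
    (hfin : ∀ x, {g | Reach E Y x g}.Finite) {δ : ℝ} (hδ : 0 < δ) {x : X} (hx : x ∈ Y) :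
    ∃ N : Set X, IsClopen N ∧ x ∈ N ∧
      (∀ y ∈ N, ∀ g, Reach E Y y g ↔ Reach E Y x g) ∧
      (∀ g, Reach E Y x g → Metric.diam (g • N) < δ) ∧
      ∀ g h, Reach E Y x g → Reach E Y x h → g ≠ h → Disjoint (g • N) (h • N) := by
  obtain ⟨S, hS⟩ := (hfin x).exists_finset_coe
  have hmem : ∀ g, Reach E Y x g → g ∈ S := fun g hg => by
    rw [← Finset.mem_coe, hS]
    exact hg
  obtain ⟨r, hr0, hrδ, hr⟩ :=
    exists_forall_two_mul_lt_dist hfree S x (δ := δ / 3) (by positivity)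
  have hev : ∀ᶠ y in 𝓝 x, (∀ g, Reach E Y y g ↔ Reach E Y x g) ∧
      ∀ g ∈ S, dist (g • y) (g • x) < r :=
    (eventually_reach_iff hY hx (hfin x)).and <| (Filter.eventually_all_finset S).2 fun g _ =>
      (continuous_const_smul g).continuousAt (Metric.ball_mem_nhds _ hr0)
  obtain ⟨O, hO, hOopen, hxO⟩ := eventually_nhds_iff.1 hev
  obtain ⟨N, hN, hxN, hNO⟩ := hX.exists_isClopen hOopen hxO
  refine ⟨N, hN, hxN, fun y hy => (hO y (hNO hy)).1, fun g hg => ?_, fun g h hg hh hne => ?_⟩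
  · refine lt_of_le_of_lt (Metric.diam_le_of_forall_dist_le (C := 2 * r) (by positivity) ?_)
      (by linarith)
    rintro _ ⟨y, hy, rfl⟩ _ ⟨z, hz, rfl⟩
    have h1 := (hO y (hNO hy)).2 g (hmem g hg)
    have h2 := (hO z (hNO hz)).2 g (hmem g hg)
    have h3 := dist_triangle_right (g • y) (g • z) (g • x)
    simp only
    linarith
  · rw [Set.disjoint_left]
    rintro _ ⟨y, hy, rfl⟩ ⟨z, hz, hzy⟩
    have h1 := (hO y (hNO hy)).2 g (hmem g hg)
    have h2 := (hO z (hNO hz)).2 h (hmem h hh)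
    have h3 := hr g (hmem g hg) h (hmem h hh) hne
    simp only at hzy
    rw [hzy] at h2
    have h4 := dist_triangle_left (g • x) (h • x) (g • y)
    linarith

/-- A clopen set on which the `Reach`-classes are finite is the disjoint union of finitely many
clopen towers with small levels whose shapes describe the `Reach`-classes. -/
theorem exists_reach_castle [CompactSpace X] [ContinuousConstSMul G X] (hX : IsZeroDimensional X)
    (hfree : ∀ (g : G) (x : X), g • x = x → g = 1) {E : Finset G} (hE : ∀ s ∈ E, s⁻¹ ∈ E)
    {Y : Set X} (hY : IsClopen Y) (hfin : ∀ x, {g | Reach E Y x g}.Finite) {δ : ℝ} (hδ : 0 < δ) :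
    ∃ (n : ℕ) (T : Fin n → Tower G X), (∀ k, IsOpen (T k).base) ∧
      (∀ k, ∀ s ∈ (T k).shape, Metric.diam (s • (T k).base) < δ) ∧
      (∀ k, ∀ y ∈ (T k).base, ∀ g, g ∈ (T k).shape ↔ Reach E Y y g) ∧
      (∀ k l, k ≠ l → Disjoint (T k).carrier (T l).carrier) ∧
      ∀ x ∈ Y, ∃ k, x ∈ (T k).carrier := by
  classical
  choose! N hN hxN hreach hdiam hdisj using
    fun x (hx : x ∈ Y) => exists_reach_base hX hfree hY hfin hδ hx
  choose S hS using fun x => (hfin x).exists_finset_coe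
  have hSmem : ∀ x g, g ∈ S x ↔ Reach E Y x g := fun x g => by
    rw [← Finset.mem_coe, hS]
    rfl
  obtain ⟨b, hbY, hb⟩ := hY.isClosed.isCompact.elim_nhds_subcover N
    fun x hx => (hN x hx).isOpen.mem_nhds (hxN x hx)
  let e := b.equivFin.symm
  let p : Fin b.card → X := fun k => e k
  have hpY : ∀ k, p k ∈ Y := fun k => hbY _ (e k).2
  let Q : Fin b.card → Set X := fun k => ⋃ s ∈ S (p k), s • N (p k)
  have hQclopen : ∀ k, IsClopen (Q k) := fun k => (S (p k)).finite_toSet.isClopen_biUnion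
    fun s _ => ⟨(hN _ (hpY k)).isClosed.smul s, (hN _ (hpY k)).isOpen.smul s⟩
  have hQ : ∀ k x, x ∈ Q k ↔ ∃ y ∈ N (p k), ∃ g, Reach E Y y g ∧ g • y = x := by
    intro k x
    simp only [Q, Set.mem_iUnion, Set.mem_smul_set, hSmem, exists_prop]
    constructor
    · rintro ⟨g, hg, y, hy, rfl⟩
      exact ⟨y, hy, g, (hreach _ (hpY k) y hy g).2 hg, rfl⟩
    · rintro ⟨y, hy, g, hg, rfl⟩
      exact ⟨g, (hreach _ (hpY k) y hy g).1 hg, y, hy, rfl⟩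
  have hQsat : ∀ k x g, Reach E Y x g → (g • x ∈ Q k ↔ x ∈ Q k) := by
    have h : ∀ k x g, Reach E Y x g → x ∈ Q k → g • x ∈ Q k := by
      intro k x g hg hx
      obtain ⟨y, hy, h, hh, rfl⟩ := (hQ k x).1 hx
      exact (hQ k _).2 ⟨y, hy, g * h, hh.trans hg, mul_smul _ _ _⟩
    refine fun k x g hg => ⟨fun hx => ?_, h k x g hg⟩
    simpa using h k _ _ (hg.symm hE) hx
  let V : Fin b.card → Set X := fun k => N (p k) \ ⋃ l ∈ Set.Iio k, Q l
  have hVN : ∀ k, V k ⊆ N (p k) := fun k => Set.sdiff_subset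
  refine ⟨b.card, fun k => ⟨V k, S (p k), fun s hs t ht hst => ?_⟩, fun k => ?_, fun k s hs => ?_,
    fun k y hy g => ?_, ?_, fun x hx => ?_⟩
  · exact (hdisj _ (hpY k) s t ((hSmem _ _).1 hs) ((hSmem _ _).1 ht) hst).mono
      (Set.smul_set_mono (hVN k)) (Set.smul_set_mono (hVN k))
  · exact (hN _ (hpY k)).isOpen.sdiff
      ((Set.toFinite _).isClosed_biUnion fun l _ => (hQclopen l).isClosed)
  · exact (Metric.diam_mono (Set.smul_set_mono (hVN k)) (Bornology.IsBounded.all _)).trans_lt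
      (hdiam _ (hpY k) s ((hSmem _ _).1 hs))
  · exact (hSmem _ _).trans (hreach _ (hpY k) y (hVN k hy) g).symm
  · have hlt : ∀ k l, l < k → Disjoint (⋃ s ∈ S (p k), s • V k) (⋃ s ∈ S (p l), s • V l) := by
      intro k l hlk
      rw [Set.disjoint_left]
      intro x hxk hxl
      have hxQ : x ∈ Q l := Set.iUnion₂_mono (fun s _ => Set.smul_set_mono (hVN l)) hxl
      obtain ⟨g, hg, y, hy, rfl⟩ := Set.mem_iUnion₂.1 hxk
      refine hy.2 (Set.mem_iUnion₂.2 ⟨l, hlk, (hQsat l y g ?_).1 hxQ⟩)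
      exact (hreach _ (hpY k) y hy.1 g).2 ((hSmem _ _).1 hg)
    intro k l hne
    rcases lt_or_gt_of_ne hne with h | h
    · exact (hlt l k h).symm
    · exact hlt k l h
  · have hex : ∃ k, x ∈ Q k := by
      obtain ⟨z, hz, hxz⟩ := Set.mem_iUnion₂.1 (hb hx)
      refine ⟨e.symm ⟨z, hz⟩, (hQ _ _).2 ⟨x, by simpa [p] using hxz, 1, .one hx, one_smul _ _⟩⟩
    obtain ⟨k, hk, hmin⟩ := WellFounded.has_min (wellFounded_lt (α := Fin b.card)) {k | x ∈ Q k} hex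
    obtain ⟨y, hy, g, hg, rfl⟩ := (hQ k x).1 hk
    refine ⟨k, Set.mem_iUnion₂.2 ⟨g, (hSmem _ _).2 ((hreach _ (hpY k) y hy g).1 hg),
      Set.smul_mem_smul_set ⟨hy, fun hyl => ?_⟩⟩⟩
    obtain ⟨l, hl, hyl⟩ := Set.mem_iUnion₂.1 hyl
    exact hmin l ((hQsat l y g hg).2 hyl) hl

theorem DadLE.fineTowDimLE [CompactSpace X] [ContinuousConstSMul G X] (hX : IsZeroDimensional X)
    (hfree : ∀ (g : G) (x : X), g • x = x → g = 1) {d : ℕ} (h : DadLE G X d) :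
    FineTowDimLE G X d := by
  classical
  intro E₀ δ hδ
  let E : Finset G := insert 1 (E₀ ∪ E₀⁻¹)
  have hE1 : 1 ∈ E := Finset.mem_insert_self _ _
  have hE0 : E₀ ⊆ E := Finset.subset_union_left.trans (Finset.subset_insert _ _)
  have hE : ∀ s ∈ E, s⁻¹ ∈ E := by
    intro s hs
    simp only [E, Finset.mem_insert, Finset.mem_union, Finset.mem_inv', inv_eq_one, inv_inv] at hs ⊢
    tauto
  obtain ⟨F, U, hU, hUcover, hF⟩ := h (E⁻¹ * E * E)
  obtain ⟨W, hW, hWU, hWcover, -⟩ := hX.exists_clopen_shrinking U hU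
    fun x => Set.mem_iUnion.1 (hUcover.ge (Set.mem_univ x))
  let Y : Fin (d + 1) → Set X := fun j => ⋃ e ∈ E, e • W j
  have hY : ∀ j, IsClopen (Y j) := fun j => E.finite_toSet.isClopen_biUnion
    fun s _ => ⟨(hW j).isClosed.smul s, (hW j).isOpen.smul s⟩
  have hYmem : ∀ j, ∀ x ∈ W j, ∀ e ∈ E, e • x ∈ Y j := fun j x hx e he =>
    Set.mem_iUnion₂.2 ⟨e, he, Set.smul_mem_smul_set hx⟩
  have hfin : ∀ j x, {g | Reach E (Y j) x g}.Finite := by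
    refine fun j x => Reach.finite_of_shadow (F := F) fun y g hg => ?_
    obtain ⟨l, hl, rfl, hm⟩ := hg.exists_list
    exact hF y l hl j fun m hml => hWU j (hm m hml)
  choose n T hopen hdiam hshape hdisj hcover using
    fun j => exists_reach_castle hX hfree hE (hY j) (hfin j) hδ
  have hleb : ∀ x, ∃ j k, ∃ t ∈ (T j k).shape, x ∈ t • (T j k).base ∧
      ∀ s ∈ E, s * t ∈ (T j k).shape := by
    intro x
    obtain ⟨j, hj⟩ := hWcover x
    obtain ⟨k, hk⟩ := hcover j x (by simpa using hYmem j x hj 1 hE1)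
    obtain ⟨t, ht, y, hy, rfl⟩ := Set.mem_iUnion₂.1 hk
    refine ⟨j, k, t, ht, Set.smul_mem_smul_set hy, fun s hs => ?_⟩
    refine (hshape j k y hy _).2 (.mul hs ((hshape j k y hy t).1 ht) ?_)
    rw [mul_smul]
    exact hYmem j _ hj s hs
  refine ⟨{T' | ∃ j k, T j k = T'}, ?_, ?_, ?_, ?_, ?_⟩
  · rintro _ ⟨j, k, rfl⟩
    exact hopen j k
  · refine Set.eq_univ_of_forall fun x => ?_
    obtain ⟨j, k, t, ht, hx, -⟩ := hleb x
    exact Set.mem_iUnion₂.2 ⟨_, ⟨j, k, rfl⟩, Set.mem_iUnion₂.2 ⟨t, ht, hx⟩⟩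
  · intro x
    obtain ⟨j, k, t, ht, hx, hs⟩ := hleb x
    exact ⟨_, ⟨j, k, rfl⟩, t, ht, hx, fun s hs' => hs s (hE0 hs')⟩
  · rintro _ ⟨j, k, rfl⟩
    exact hdiam j k
  · choose c k hck using fun T' : {T' | ∃ j k, T j k = T'} => T'.2
    refine ⟨c, fun T₁ T₂ hne hc => ?_⟩
    have key : ∀ j₁ k₁ j₂ k₂, j₁ = j₂ → T j₁ k₁ ≠ T j₂ k₂ →
        Disjoint (T j₁ k₁).carrier (T j₂ k₂).carrier := by
      rintro j k₁ _ k₂ rfl hne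
      exact hdisj j k₁ k₂ fun h => hne (h ▸ rfl)
    have := key (c T₁) (k T₁) (c T₂) (k T₂) hc (by
      rw [hck, hck]
      exact fun h => hne (Subtype.ext h))
    rwa [hck, hck] at this

theorem FineTowDimLE.towDimLE {d : ℕ} (h : FineTowDimLE G X d) : TowDimLE G X d := fun E =>
  let ⟨𝒯, h1, h2, h3, _, h5⟩ := h E 1 one_pos
  ⟨𝒯, h1, h2, h3, h5⟩

end Castle

end AsymptoticToFineTower

section TowerToAmenability

variable {G X : Type*} [Group G]

theorem norm_eq_sum_of_support_subset {G : Type*} (μ : EllOne G) (H : Finset G) (hH : ∀ t ∉ H, μ t = 0) :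
    ‖μ‖ = ∑ t ∈ H, |μ t| := by
  rw [lp.norm_eq_tsum_rpow (by norm_num), ENNReal.toReal_one, div_one, Real.rpow_one]
  simp only [Real.rpow_one, Real.norm_eq_abs]
  exact tsum_eq_sum fun t ht => by rw [hH t ht, abs_zero]

/-- The element of `ℓ¹(G)` given by a function vanishing outside a finite set. -/
def ofFiniteSupport {G : Type*} (f : G → ℝ) (H : Finset G) (hf : ∀ t ∉ H, f t = 0) : EllOne G :=
  ⟨f, memℓp_gen (by
    refine summable_of_ne_finset_zero (s := H) fun t ht => ?_
    rw [hf t ht]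
    norm_num)⟩

/-- Normalising two nonnegative vectors to probability vectors at most doubles their distance,
relative to the mass of one of them. -/
theorem sum_abs_div_sub_div_le {ι : Type*} (H : Finset ι) (a b : ι → ℝ) (hb : ∀ t, 0 ≤ b t)
    (hA : 0 < ∑ t ∈ H, a t) (hB : 0 < ∑ t ∈ H, b t) :
    ∑ t ∈ H, |a t / (∑ t ∈ H, a t) - b t / (∑ t ∈ H, b t)| ≤
      2 * (∑ t ∈ H, |a t - b t|) / (∑ t ∈ H, a t) := by
  set A := ∑ t ∈ H, a t with hAdef
  set B := ∑ t ∈ H, b t with hBdef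
  have hAB : |B - A| ≤ ∑ t ∈ H, |a t - b t| := by
    rw [abs_sub_comm, hAdef, hBdef, ← Finset.sum_sub_distrib]
    exact Finset.abs_sum_le_sum_abs _ _
  have hterm : ∀ t ∈ H, |a t / A - b t / B| ≤ |a t - b t| / A + b t * (|B - A| / (A * B)) := by
    intro t _
    have : a t / A - b t / B = (a t - b t) / A + b t * ((B - A) / (A * B)) := by
      field_simp
      ring
    rw [this]
    refine (abs_add_le _ _).trans_eq ?_
    rw [abs_div, abs_mul, abs_div, abs_of_pos hA, abs_of_pos (mul_pos hA hB), abs_of_nonneg (hb t)]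
  calc _ ≤ ∑ t ∈ H, (|a t - b t| / A + b t * (|B - A| / (A * B))) := Finset.sum_le_sum hterm
    _ = (∑ t ∈ H, |a t - b t|) / A + |B - A| / A := by
      rw [Finset.sum_add_distrib, ← Finset.sum_div, ← Finset.sum_mul, ← hBdef]
      field_simp
    _ ≤ _ := by
      rw [← add_div, two_mul]
      gcongr

/-- The number of `k < n` with `B k * t ⊆ S`. -/
noncomputable def depth (B : ℕ → Finset G) (n : ℕ) (S : Finset G) (t : G) : ℝ :=
  open Classical in ∑ k ∈ Finset.range n, if ∀ b ∈ B k, b * t ∈ S then 1 else 0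

section Depth

variable {B : ℕ → Finset G} {n : ℕ} {S : Finset G} {t : G}

theorem depth_nonneg : 0 ≤ depth B n S t :=
  Finset.sum_nonneg fun _ _ => by split_ifs <;> norm_num

theorem depth_eq_zero (hB : ∀ k, 1 ∈ B k) (ht : t ∉ S) : depth B n S t = 0 :=
  Finset.sum_eq_zero fun k _ => if_neg fun h => ht (by simpa using h 1 (hB k))

theorem depth_eq_natCast (h : ∀ k < n, ∀ b ∈ B k, b * t ∈ S) : depth B n S t = n := by
  rw [depth, Finset.sum_congr rfl fun k hk => if_pos (h k (Finset.mem_range.1 hk))]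
  simp

theorem depth_le_depth_mul_add_one {g : G} (hg : ∀ k, ∀ b ∈ B k, b * g ∈ B (k + 1)) :
    depth B n S t ≤ depth B n S (g * t) + 1 := by
  classical
  calc depth B n S t
      ≤ ∑ k ∈ Finset.range (n + 1), if ∀ b ∈ B k, b * t ∈ S then (1 : ℝ) else 0 :=
        Finset.sum_le_sum_of_subset_of_nonneg (Finset.range_mono n.le_succ)
          fun _ _ _ => by split_ifs <;> norm_num
    _ = (∑ k ∈ Finset.range n, if ∀ b ∈ B (k + 1), b * t ∈ S then (1 : ℝ) else 0) +
          if ∀ b ∈ B 0, b * t ∈ S then (1 : ℝ) else 0 := Finset.sum_range_succ' _ _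
    _ ≤ _ := by
      refine add_le_add (Finset.sum_le_sum fun k _ => ?_) (by split_ifs <;> norm_num)
      split_ifs with h1 h2
      · exact le_rfl
      · exact absurd (fun b hb => by rw [← mul_assoc]; exact h1 _ (hg k b hb)) h2
      all_goals norm_num

theorem abs_depth_sub_depth_le {g : G} (hg : ∀ k, ∀ b ∈ B k, b * g ∈ B (k + 1))
    (hg' : ∀ k, ∀ b ∈ B k, b * g⁻¹ ∈ B (k + 1)) :
    |depth B n S t - depth B n S (g⁻¹ * t)| ≤ 1 := by
  have h1 := depth_le_depth_mul_add_one (n := n) (S := S) (t := t) hg'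
  have h2 := depth_le_depth_mul_add_one (n := n) (S := S) (t := g⁻¹ * t) hg
  rw [mul_inv_cancel_left] at h2
  exact abs_le.2 ⟨by linarith, by linarith⟩

end Depth

variable [MulAction G X] {ι : Type*} [Fintype ι]

/-- The number of indices `i` for which `x` lies in the level `t • C i` of the tower
`(C i, S i)`. -/
noncomputable def levelCount (S : ι → Finset G) (C : ι → Set X) (x : X) (t : G) : ℝ :=
  open Classical in ∑ i, if t⁻¹ • x ∈ C i ∧ t ∈ S i then 1 else 0

/-- The sum of the depths of `t` in those towers `(C i, S i)` for which `x` lies in the level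
`t • C i`. -/
noncomputable def levelWeight (B : ℕ → Finset G) (n : ℕ) (S : ι → Finset G) (C : ι → Set X) (x : X) (t : G) :
    ℝ :=
  open Classical in ∑ i, if t⁻¹ • x ∈ C i then depth B n (S i) t else 0

section Level

variable {B : ℕ → Finset G} {n : ℕ} {S : ι → Finset G} {C : ι → Set X} {x : X} {t : G}

theorem levelCount_nonneg : 0 ≤ levelCount S C x t :=
  Finset.sum_nonneg fun _ _ => by split_ifs <;> norm_num

theorem sum_levelCount_le {d : ℕ} {c : ι → Fin (d + 1)}
    (hdisj : ∀ i j, ∀ s ∈ S i, ∀ t ∈ S j, s⁻¹ • x ∈ C i → t⁻¹ • x ∈ C j → c i = c j →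
      i = j ∧ s = t) (K : Finset G) : ∑ t ∈ K, levelCount S C x t ≤ d + 1 := by
  classical
  simp only [levelCount]
  rw [← Finset.sum_product', Finset.sum_boole]
  have h := Finset.card_le_card_of_injOn (t := (Finset.univ : Finset (Fin (d + 1))))
    (s := {p ∈ K ×ˢ (Finset.univ : Finset ι) | p.1⁻¹ • x ∈ C p.2 ∧ p.1 ∈ S p.2})
    (fun p => c p.2) (fun _ _ => Finset.mem_univ _) (by
      rintro ⟨s, i⟩ hs ⟨t, j⟩ ht hc
      simp only [Finset.coe_filter, Set.mem_ofPred_eq] at hs ht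
      obtain ⟨rfl, rfl⟩ := hdisj i j s hs.2.2 t ht.2.2 hs.2.1 ht.2.1 hc
      rfl)
  rw [Finset.card_univ, Fintype.card_fin] at h
  exact_mod_cast h

theorem levelWeight_nonneg : 0 ≤ levelWeight B n S C x t :=
  Finset.sum_nonneg fun _ _ => by split_ifs; exacts [depth_nonneg, le_rfl]

theorem levelWeight_eq_zero (hB : ∀ k, 1 ∈ B k) (ht : ∀ i, t ∉ S i) :
    levelWeight B n S C x t = 0 :=
  Finset.sum_eq_zero fun i _ => by rw [depth_eq_zero hB (ht i), ite_self]

theorem one_le_levelCount (hB : ∀ k, 1 ∈ B k) (h : levelWeight B n S C x t ≠ 0) :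
    1 ≤ levelCount S C x t := by
  classical
  obtain ⟨i, -, hi⟩ := Finset.exists_ne_zero_of_sum_ne_zero h
  have hx : t⁻¹ • x ∈ C i := by
    by_contra hx
    exact hi (if_neg hx)
  have ht : t ∈ S i := by
    by_contra ht
    rw [depth_eq_zero hB ht, ite_self] at hi
    exact hi rfl
  calc (1 : ℝ) = if t⁻¹ • x ∈ C i ∧ t ∈ S i then 1 else 0 := (if_pos ⟨hx, ht⟩).symm
    _ ≤ _ := Finset.single_le_sum
      (f := fun i => if t⁻¹ • x ∈ C i ∧ t ∈ S i then (1 : ℝ) else 0)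
      (fun _ _ => by split_ifs <;> norm_num) (Finset.mem_univ i)

theorem natCast_le_levelWeight {i : ι} (hx : t⁻¹ • x ∈ C i)
    (h : ∀ k < n, ∀ b ∈ B k, b * t ∈ S i) : (n : ℝ) ≤ levelWeight B n S C x t := by
  classical
  calc (n : ℝ) = if t⁻¹ • x ∈ C i then depth B n (S i) t else 0 := by
        rw [if_pos hx, depth_eq_natCast h]
    _ ≤ _ := Finset.single_le_sum
      (f := fun i => if t⁻¹ • x ∈ C i then depth B n (S i) t else 0)
      (fun _ _ => by split_ifs; exacts [depth_nonneg, le_rfl]) (Finset.mem_univ i)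

theorem abs_levelWeight_smul_sub_le {g : G} (hB : ∀ k, 1 ∈ B k)
    (hg : ∀ k, ∀ b ∈ B k, b * g ∈ B (k + 1)) (hg' : ∀ k, ∀ b ∈ B k, b * g⁻¹ ∈ B (k + 1)) :
    |levelWeight B n S C (g • x) t - levelWeight B n S C x (g⁻¹ * t)| ≤
      levelCount S C (g • x) t + levelCount S C x (g⁻¹ * t) := by
  classical
  have hsmul : (g⁻¹ * t)⁻¹ • x = t⁻¹ • g • x := by rw [mul_inv_rev, inv_inv, mul_smul]
  simp only [levelWeight, levelCount]
  rw [hsmul, ← Finset.sum_sub_distrib, ← Finset.sum_add_distrib]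
  refine (Finset.abs_sum_le_sum_abs _ _).trans (Finset.sum_le_sum fun i _ => ?_)
  by_cases hx : t⁻¹ • g • x ∈ C i
  · simp only [hx, if_true, true_and]
    by_cases h1 : t ∈ S i
    · rw [if_pos h1]
      refine (abs_depth_sub_depth_le hg hg').trans ?_
      split_ifs <;> norm_num
    · by_cases h2 : g⁻¹ * t ∈ S i
      · rw [if_neg h1, if_pos h2, zero_add]
        exact abs_depth_sub_depth_le hg hg'
      · rw [depth_eq_zero hB h1, depth_eq_zero hB h2]
        simp [h1, h2]
  · simp [hx]

theorem eventually_levelWeight_eq [TopologicalSpace X] [ContinuousConstSMul G X]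
    (hC : ∀ i, IsClopen (C i)) (hB : ∀ k, 1 ∈ B k) (x : X) :
    ∀ᶠ y in 𝓝 x, levelWeight B n S C y = levelWeight B n S C x := by
  classical
  let H : Finset G := Finset.univ.biUnion S
  have hev : ∀ᶠ y in 𝓝 x, ∀ t ∈ H, ∀ i, t⁻¹ • y ∈ C i ↔ t⁻¹ • x ∈ C i := by
    refine (Filter.eventually_all_finset H).2 fun t _ => Filter.eventually_all.2 fun i => ?_
    have hcont : ContinuousAt (fun y : X => t⁻¹ • y) x := (continuous_const_smul t⁻¹).continuousAt
    by_cases h : t⁻¹ • x ∈ C i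
    · filter_upwards [hcont ((hC i).isOpen.mem_nhds h)] with y hy
      exact iff_of_true hy h
    · filter_upwards [hcont ((hC i).compl.isOpen.mem_nhds h)] with y hy
      exact iff_of_false hy h
  filter_upwards [hev] with y hy
  funext t
  by_cases ht : t ∈ H
  · simp only [levelWeight, hy t ht]
  · have ht' : ∀ i, t ∉ S i := fun i hi =>
      ht (Finset.mem_biUnion.2 ⟨i, Finset.mem_univ i, hi⟩)
    rw [levelWeight_eq_zero hB ht', levelWeight_eq_zero hB ht']

end Level

/-- The normalised level weights of a clopen, coloured, sufficiently Lebesgue family of towers form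
an approximately equivariant map into the simplex. -/
theorem exists_approx_equivariant [TopologicalSpace X] [ContinuousConstSMul G X] {d : ℕ}
    {S : ι → Finset G} {C : ι → Set X} (hC : ∀ i, IsClopen (C i)) (c : ι → Fin (d + 1))
    (hdisj : ∀ x, ∀ i j, ∀ s ∈ S i, ∀ t ∈ S j, s⁻¹ • x ∈ C i → t⁻¹ • x ∈ C j → c i = c j →
      i = j ∧ s = t)
    {B : ℕ → Finset G} (hB : ∀ k, 1 ∈ B k) {n : ℕ} (hn : 0 < n)
    (hleb : ∀ x, ∃ i, ∃ t ∈ S i, t⁻¹ • x ∈ C i ∧ ∀ k < n, ∀ b ∈ B k, b * t ∈ S i) :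
    ∃ φ : X → EllOne G, Continuous φ ∧ (∀ x, φ x ∈ probSimplex G d) ∧
      ∀ g, (∀ k, ∀ b ∈ B k, b * g ∈ B (k + 1)) → (∀ k, ∀ b ∈ B k, b * g⁻¹ ∈ B (k + 1)) →
        ∀ x, ‖φ (g • x) - leftTranslate g (φ x)‖ ≤ 4 * (d + 1) / n := by
  classical
  let H : Finset G := Finset.univ.biUnion S
  let w : X → G → ℝ := levelWeight B n S C
  have hw0 : ∀ x, ∀ t ∉ H, w x t = 0 := fun x t ht => levelWeight_eq_zero hB fun i hi =>
    ht (Finset.mem_biUnion.2 ⟨i, Finset.mem_univ i, hi⟩)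
  let W : X → ℝ := fun x => ∑ t ∈ H, w x t
  have hn' : (0 : ℝ) < n := by exact_mod_cast hn
  have hWn : ∀ x, (n : ℝ) ≤ W x := by
    intro x
    obtain ⟨i, t, ht, hx, hb⟩ := hleb x
    exact (natCast_le_levelWeight hx hb).trans (Finset.single_le_sum (f := w x)
      (fun _ _ => levelWeight_nonneg) (Finset.mem_biUnion.2 ⟨i, Finset.mem_univ i, ht⟩))
  have hW : ∀ x, 0 < W x := fun x => hn'.trans_le (hWn x)
  have hWK : ∀ x (K : Finset G), H ⊆ K → ∑ t ∈ K, w x t = W x := fun x K hK =>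
    (Finset.sum_subset hK fun t _ ht => hw0 x t ht).symm
  let φ : X → EllOne G := fun x => ofFiniteSupport (fun t => w x t / W x) H fun t ht => by
    rw [hw0 x t ht, zero_div]
  have hφ : ∀ x t, φ x t = w x t / W x := fun _ _ => rfl
  refine ⟨φ, ?_, fun x => ⟨fun t => ?_, ?_, ?_⟩, fun g hg hg' x => ?_⟩
  · refine IsLocallyConstant.continuous ((IsLocallyConstant.iff_eventually_eq φ).2 fun x => ?_)
    filter_upwards [eventually_levelWeight_eq hC hB x] with y hy
    have hy' : w y = w x := hy
    apply lp.ext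
    funext t
    rw [hφ, hφ]
    simp only [W, hy']
  · exact div_nonneg levelWeight_nonneg (hW x).le
  · have h1 : ∑ t ∈ H, φ x t = 1 := by
      simp only [hφ]
      rw [← Finset.sum_div]
      exact div_self (hW x).ne'
    rw [← h1]
    exact hasSum_sum_of_ne_finset_zero fun t ht => by rw [hφ, hw0 x t ht, zero_div]
  · have hsupp : (Function.support fun t => φ x t) ⊆ (H.filter fun t => w x t ≠ 0 : Finset G) := by
      intro t ht
      have ht' : w x t ≠ 0 := fun h => ht (by simp only [hφ, h, zero_div])
      rw [Finset.coe_filter]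
      refine ⟨?_, ht'⟩
      by_contra h
      exact ht' (hw0 x t h)
    refine (Set.encard_le_encard hsupp).trans ?_
    rw [Set.encard_coe_eq_coe_finsetCard]
    have h1 : ((H.filter fun t => w x t ≠ 0).card : ℝ) ≤ d + 1 := by
      refine le_trans ?_ (sum_levelCount_le (hdisj x) (H.filter fun t => w x t ≠ 0))
      rw [← nsmul_one]
      exact Finset.card_nsmul_le_sum _ _ _ fun t ht =>
        one_le_levelCount hB (Finset.mem_filter.1 ht).2
    exact_mod_cast h1
  · let K : Finset G := H ∪ g • H
    have hK : ∀ t ∉ K, t ∉ H ∧ g⁻¹ * t ∉ H := by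
      intro t ht
      rw [Finset.mem_union, not_or, ← Finset.inv_smul_mem_iff] at ht
      exact ht
    have hreindex : ∀ f : G → ℝ, ∑ t ∈ K, f (g⁻¹ * t) = ∑ t ∈ g⁻¹ • K, f t := by
      intro f
      exact (Finset.sum_image fun s _ t _ h => mul_left_cancel h).symm
    have hsum1 : ∑ t ∈ K, w (g • x) t = W (g • x) := hWK _ _ Finset.subset_union_left
    have hsum2 : ∑ t ∈ K, w x (g⁻¹ * t) = W x := by
      rw [hreindex]
      refine hWK _ _ fun t ht => ?_
      rw [Finset.mem_inv_smul_finset_iff]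
      exact Finset.mem_union_right _ (Finset.smul_mem_smul_finset ht)
    have hD : ∑ t ∈ K, |w (g • x) t - w x (g⁻¹ * t)| ≤ 2 * (d + 1) := by
      refine (Finset.sum_le_sum fun t _ => abs_levelWeight_smul_sub_le hB hg hg').trans ?_
      rw [Finset.sum_add_distrib, hreindex (levelCount S C x), two_mul]
      exact add_le_add (sum_levelCount_le (hdisj _) _) (sum_levelCount_le (hdisj _) _)
    have happly : ∀ t, (φ (g • x) - leftTranslate g (φ x)) t =
        w (g • x) t / W (g • x) - w x (g⁻¹ * t) / W x := fun _ => rfl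
    rw [norm_eq_sum_of_support_subset _ K fun t ht => by
      rw [happly, hw0 _ _ (hK t ht).1, hw0 _ _ (hK t ht).2, zero_div, zero_div, sub_zero]]
    simp only [happly]
    have hmain := sum_abs_div_sub_div_le K (w (g • x)) (fun t => w x (g⁻¹ * t))
      (fun _ => levelWeight_nonneg) (by rw [hsum1]; exact hW _) (by rw [hsum2]; exact hW _)
    rw [hsum1, hsum2] at hmain
    refine hmain.trans (div_le_div₀ (by positivity) ?_ hn' (hWn _))
    linarith

/-- In a zero-dimensional space the bases of finitely many of the towers may be shrunk to clopen
sets, keeping the Lebesgue property. -/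
theorem TowDimLE.exists_clopen [MetricSpace X] [CompactSpace X] [ContinuousConstSMul G X]
    (hX : IsZeroDimensional X) {d : ℕ} (h : TowDimLE G X d) (E : Finset G) :
    ∃ (I : Set (Tower G X)) (_ : I.Finite) (C : I → Set X) (c : I → Fin (d + 1)),
      (∀ i, IsClopen (C i)) ∧
      (∀ x, ∀ i j : I, ∀ s ∈ i.1.shape, ∀ t ∈ j.1.shape, s⁻¹ • x ∈ C i → t⁻¹ • x ∈ C j →
        c i = c j → i = j ∧ s = t) ∧
      ∀ x, ∃ i : I, ∃ t ∈ i.1.shape, t⁻¹ • x ∈ C i ∧ ∀ e ∈ E, e * t ∈ i.1.shape := by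
  classical
  obtain ⟨𝒯, hopen, -, hleb, c, hc⟩ := h E
  let J := {p : 𝒯 × G // p.2 ∈ p.1.1.shape ∧ ∀ e ∈ E, e * p.2 ∈ p.1.1.shape}
  obtain ⟨W, hW, hWU, hWcover, hWfin⟩ := hX.exists_clopen_shrinking
    (fun p : J => p.1.2 • p.1.1.1.base) (fun p => (hopen _ p.1.1.2).smul _) (by
      intro x
      obtain ⟨T, hT, t, ht, hx, he⟩ := hleb x
      exact ⟨⟨⟨⟨T, hT⟩, t⟩, ht, he⟩, hx⟩)
  let P := {p : J | (W p).Nonempty}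
  let I : Set (Tower G X) := (fun p : J => p.1.1.1) '' P
  have hI : I ⊆ 𝒯 := by
    rintro _ ⟨p, -, rfl⟩
    exact p.1.1.2
  let C : I → Set X := fun i => ⋃ p ∈ {p | p ∈ P ∧ p.1.1.1 = i.1}, p.1.2⁻¹ • W p
  have hCbase : ∀ i, C i ⊆ i.1.base := by
    intro i
    refine Set.iUnion₂_subset ?_
    rintro p ⟨-, hp⟩
    rw [← hp, Set.smul_set_subset_iff_subset_inv_smul_set, inv_inv]
    exact hWU p
  refine ⟨I, hWfin.image _, C, fun i => c ⟨i.1, hI i.2⟩, fun i => ?_, ?_, fun x => ?_⟩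
  · exact (hWfin.subset fun p hp => hp.1).isClopen_biUnion
      fun p _ => ⟨(hW p).isClosed.smul _, (hW p).isOpen.smul _⟩
  · intro x i j s hs t ht hx hy hcol
    have hxi : x ∈ s • i.1.base := Set.mem_smul_set_iff_inv_smul_mem.2 (hCbase i hx)
    have hxj : x ∈ t • j.1.base := Set.mem_smul_set_iff_inv_smul_mem.2 (hCbase j hy)
    obtain rfl : i = j := by
      by_contra hne
      exact Set.disjoint_left.1
        (hc ⟨i.1, hI i.2⟩ ⟨j.1, hI j.2⟩ (fun h => hne (Subtype.ext (congrArg (fun T => T.1) h)))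
          hcol) (Set.mem_iUnion₂.2 ⟨s, hs, hxi⟩) (Set.mem_iUnion₂.2 ⟨t, ht, hxj⟩)
    refine ⟨rfl, ?_⟩
    by_contra hne
    exact Set.disjoint_left.1 (i.1.disjoint_levels hs ht hne) hxi hxj
  · obtain ⟨p, hp⟩ := hWcover x
    refine ⟨⟨p.1.1.1, p, ⟨x, hp⟩, rfl⟩, p.1.2, p.2.1, ?_, p.2.2⟩
    exact Set.mem_iUnion₂.2 ⟨p, ⟨⟨x, hp⟩, rfl⟩, Set.smul_mem_smul_set hp⟩

theorem TowDimLE.amDimLE [MetricSpace X] [CompactSpace X] [ContinuousConstSMul G X]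
    (hX : IsZeroDimensional X) {d : ℕ} (h : TowDimLE G X d) : AmDimLE G X d := by
  classical
  intro F ε hε
  obtain ⟨n, hn⟩ := exists_nat_gt (4 * ((d : ℝ) + 1) / ε)
  have hn0 : (0 : ℝ) < n := lt_trans (by positivity) hn
  let A : Finset G := insert 1 (F ∪ F⁻¹)
  have hA : 1 ∈ A := Finset.mem_insert_self _ _
  obtain ⟨I, hI, C, c, hC, hdisj, hleb⟩ := h.exists_clopen hX (A ^ n)
  have := hI.fintype
  obtain ⟨φ, hφ, hsimplex, hequi⟩ := exists_approx_equivariant (S := fun i : I => i.1.shape)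
    (B := fun k => A ^ k) (n := n) hC c hdisj (fun k => Finset.one_mem_pow hA)
    (by exact_mod_cast hn0) (by
      intro x
      obtain ⟨i, t, ht, hx, he⟩ := hleb x
      exact ⟨i, t, ht, hx, fun k hk b hb => he b (Finset.pow_subset_pow_right hA hk.le hb)⟩)
  have hmul : ∀ g ∈ A, ∀ k, ∀ b ∈ A ^ k, b * g ∈ A ^ (k + 1) := fun g hg k b hb => by
    rw [pow_succ]
    exact Finset.mul_mem_mul hb hg
  refine ⟨φ, hφ, hsimplex, fun g hg x => (hequi g (hmul g ?_) (hmul g⁻¹ ?_) x).trans_lt ?_⟩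
  · exact Finset.mem_insert_of_mem (Finset.mem_union_left _ hg)
  · exact Finset.mem_insert_of_mem (Finset.mem_union_right _ (Finset.inv_mem_inv hg))
  · rwa [div_lt_comm₀ hn0 hε]

end TowerToAmenability

section AmenabilityToAsymptotic

variable {G X : Type*}

theorem abs_apply_le_norm (μ : EllOne G) (t : G) : |μ t| ≤ ‖μ‖ :=
  lp.norm_apply_le_norm one_ne_zero μ t

theorem abs_apply_sub_apply_le_norm_sub (μ ν : EllOne G) (t : G) : |μ t - ν t| ≤ ‖μ - ν‖ :=
  abs_apply_le_norm (μ - ν) t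

/-- `A` carries the `#A` largest values of `μ`, separated by more than `γ` from the others. -/
def HasGap (μ : G → ℝ) (γ : ℝ) (A : Finset G) : Prop :=
  ∀ a ∈ A, ∀ b ∉ A, μ b + γ < μ a

theorem isOpen_exists_hasGap (γ : ℝ) (A : Finset G) :
    IsOpen {μ : EllOne G | ∃ η > γ, HasGap μ η A} := by
  rw [Metric.isOpen_iff]
  rintro μ ⟨η, hη, h⟩
  refine ⟨(η - γ) / 4, by linarith, fun ν hν => ?_⟩
  rw [Metric.mem_ball, dist_eq_norm] at hν
  have key : ∀ t, |ν t - μ t| < (η - γ) / 4 :=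
    fun t => (abs_apply_sub_apply_le_norm_sub ν μ t).trans_lt hν
  refine ⟨(γ + η) / 2, by linarith, fun a ha b hb => ?_⟩
  have h1 := h a ha b hb
  have h2 := abs_lt.1 (key a)
  have h3 := abs_lt.1 (key b)
  linarith

/-- A probability vector with at most `d + 1` atoms has a gap of size more than
`1 / (d + 2) ^ 2` after its `j` largest values, for some `1 ≤ j ≤ d + 1`. -/
theorem exists_hasGap {d : ℕ} {μ : EllOne G} (hμ : μ ∈ probSimplex G d) :
    ∃ (j : Fin (d + 1)) (A : Finset G), A.card = j + 1 ∧ HasGap μ (1 / (d + 2) ^ 2) A := by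
  classical
  obtain ⟨hpos, hsum, hcard⟩ := hμ
  have hfin : (Function.support fun t => μ t).Finite :=
    Set.finite_of_encard_le_coe (k := d + 1) (by exact_mod_cast hcard)
  obtain ⟨s, hs⟩ := hfin.exists_finset_coe
  have hs0 : ∀ t ∉ s, μ t = 0 := by
    intro t ht
    by_contra h
    exact ht (by rw [← Finset.mem_coe, hs]; exact h)
  have hscard : s.card ≤ d + 1 := by
    rw [← hs, Set.encard_coe_eq_coe_finsetCard] at hcard
    exact_mod_cast hcard
  have hs1 : ∑ t ∈ s, μ t = 1 := (hasSum_sum_of_ne_finset_zero hs0).unique hsum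
  have hne : s.Nonempty := by
    by_contra h
    rw [Finset.not_nonempty_iff_eq_empty] at h
    simp [h] at hs1
  obtain ⟨t₀, ht₀, hmax⟩ : ∃ t ∈ s, 1 / ((d : ℝ) + 1) ≤ μ t := by
    refine Finset.exists_le_of_sum_le hne ?_
    rw [hs1, Finset.sum_const, nsmul_eq_mul, mul_one_div, div_le_one (by positivity)]
    exact_mod_cast hscard
  set γ : ℝ := 1 / (d + 2) ^ 2 with hγ
  have hγ0 : 0 < γ := by positivity
  have hlarge : ((d : ℝ) + 1) * γ < μ t₀ := by
    refine lt_of_lt_of_le ?_ hmax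
    rw [hγ, mul_one_div, div_lt_div_iff₀ (by positivity) (by positivity)]
    nlinarith [(Nat.cast_nonneg d : (0 : ℝ) ≤ d)]
  obtain ⟨k, hk⟩ : ∃ k : Fin (d + 1), ∀ t, ¬ ((k : ℝ) * γ < μ t ∧ μ t ≤ (k + 1) * γ) := by
    by_contra! hall
    choose f hf using hall
    have hinj : Function.Injective f := by
      have hle : ∀ k l, f k = f l → (k : ℕ) ≤ l := by
        intro k l hkl
        by_contra! hlt
        have h1 := (hf k).1
        have h2 := (hf l).2
        rw [← hkl] at h2
        have h3 : ((l : ℕ) : ℝ) + 1 ≤ (k : ℕ) := by exact_mod_cast hlt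
        nlinarith
      exact fun k l hkl => Fin.ext (le_antisymm (hle k l hkl) (hle l k hkl.symm))
    have hmem : ∀ k ∈ (Finset.univ : Finset (Fin (d + 1))), f k ∈ s.erase t₀ := by
      intro k _
      rw [Finset.mem_erase]
      constructor
      · intro h
        have h1 := (hf k).2
        have h2 : ((k : ℕ) : ℝ) + 1 ≤ d + 1 := by exact_mod_cast k.2
        rw [h] at h1
        nlinarith
      · by_contra h
        have h1 := (hf k).1
        rw [hs0 _ h] at h1
        have : 0 ≤ ((k : ℕ) : ℝ) * γ := by positivity
        linarith
    have h := Finset.card_le_card_of_injOn f hmem hinj.injOn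
    rw [Finset.card_erase_of_mem ht₀, Finset.card_univ, Fintype.card_fin] at h
    omega
  have hk0 : 0 ≤ ((k : ℕ) : ℝ) * γ := by positivity
  have hk1 : ((k : ℕ) : ℝ) + 1 ≤ d + 1 := by exact_mod_cast k.2
  set A := s.filter fun t => (k : ℝ) * γ < μ t with hA
  have hA0 : 0 < A.card := Finset.card_pos.2 ⟨t₀, by
    rw [hA, Finset.mem_filter]
    exact ⟨ht₀, by nlinarith⟩⟩
  have hA1 : A.card ≤ d + 1 := (Finset.card_filter_le _ _).trans hscard
  refine ⟨⟨A.card - 1, by omega⟩, A, by simp only []; omega, fun a ha b hb => ?_⟩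
  rw [hA, Finset.mem_filter] at ha hb
  have h1 : ((k : ℕ) + 1 : ℝ) * γ < μ a := by
    by_contra! h
    exact hk a ⟨ha.2, h⟩
  have h2 : μ b ≤ (k : ℕ) * γ := by
    by_cases hbs : b ∈ s
    · by_contra! h
      exact hb ⟨hbs, h⟩
    · rw [hs0 b hbs]
      exact hk0
  linarith

theorem HasGap.eq_smul [Group G] [DecidableEq G] {γ : ℝ} {μ ν : EllOne G} {A B : Finset G} (s : G)
    (hA : HasGap μ γ A) (hB : HasGap ν γ B) (hcard : A.card = B.card)
    (hclose : ‖ν - leftTranslate s μ‖ ≤ γ) : B = s • A := by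
  have key : ∀ t, |ν t - μ (s⁻¹ * t)| ≤ γ := fun t =>
    (abs_apply_sub_apply_le_norm_sub ν (leftTranslate s μ) t).trans hclose
  have hcard' : B.card = (s • A).card := by rw [Finset.card_smul_finset, hcard]
  by_contra hne
  obtain ⟨a, ha, ha'⟩ : ∃ a ∈ B, a ∉ s • A := by
    by_contra! h
    exact hne (Finset.eq_of_subset_of_card_le h hcard'.ge)
  obtain ⟨b, hb, hb'⟩ : ∃ b ∈ s • A, b ∉ B := by
    by_contra! h
    exact hne (Finset.eq_of_subset_of_card_le h hcard'.le).symm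
  rw [← Finset.inv_smul_mem_iff, smul_eq_mul] at ha' hb
  have h1 := hA _ hb _ ha'
  have h2 := hB _ ha _ hb'
  have h3 := abs_le.1 (key a)
  have h4 := abs_le.1 (key b)
  linarith

/-- The atoms of mass more than `γ` of a continuous compact family of elements of `ℓ¹(G)` lie in a
common finite set. -/
theorem exists_finset_forall_apply_le [TopologicalSpace X] [CompactSpace X] {φ : X → EllOne G}
    (hφ : Continuous φ) (hfin : ∀ x, (Function.support fun t => φ x t).Finite) {γ : ℝ}
    (hγ : 0 < γ) : ∃ K : Finset G, ∀ x, ∀ t ∉ K, φ x t ≤ γ := by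
  classical
  have hnhds : ∀ x, ∀ᶠ y in 𝓝 x, ∀ t ∉ (hfin x).toFinset, φ y t ≤ γ := by
    intro x
    filter_upwards [hφ.continuousAt.eventually (Metric.ball_mem_nhds (φ x) hγ)] with y hy t ht
    rw [dist_eq_norm] at hy
    have h0 : φ x t = 0 := by simpa using ht
    have h1 := (abs_apply_sub_apply_le_norm_sub (φ y) (φ x) t).trans_lt hy
    rw [h0, sub_zero] at h1
    exact (lt_of_abs_lt h1).le
  obtain ⟨b, hb⟩ := CompactSpace.elim_nhds_subcover _ hnhds
  refine ⟨b.biUnion fun x => (hfin x).toFinset, fun y t ht => ?_⟩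
  obtain ⟨x, hx, hy⟩ := Set.mem_iUnion₂.1 (hb.ge (Set.mem_univ y))
  exact hy t fun h => ht (Finset.mem_biUnion.2 ⟨x, hx, h⟩)

theorem AmDimLE.dadLE [Group G] [TopologicalSpace X] [CompactSpace X] [MulAction G X] {d : ℕ}
    (h : AmDimLE G X d) : DadLE G X d := by
  classical
  intro E
  set γ : ℝ := 1 / (2 * (d + 2) ^ 2) with hγ
  have hγ0 : 0 < γ := by positivity
  obtain ⟨φ, hφ, hsimplex, hclose⟩ := h E γ hγ0
  obtain ⟨K, hsub⟩ : ∃ K : Finset G, ∀ y (A : Finset G), HasGap (φ y) γ A → A ⊆ K := by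
    cases finite_or_infinite G
    · have := Fintype.ofFinite G
      exact ⟨Finset.univ, fun _ A _ => A.subset_univ⟩
    · obtain ⟨K, hK⟩ := exists_finset_forall_apply_le hφ (fun x =>
        Set.finite_of_encard_le_coe (k := d + 1) (by exact_mod_cast (hsimplex x).2.2)) hγ0
      refine ⟨K, fun y A hA a ha => ?_⟩
      by_contra haK
      obtain ⟨b, hb⟩ := Infinite.exists_notMem_finset A
      have h1 := hA a ha b hb
      have h2 := hK y a haK
      have h3 := (hsimplex y).1 b
      linarith
  refine ⟨K * K⁻¹, fun j => {x | ∃ A : Finset G, A.card = j + 1 ∧ ∃ η > γ, HasGap (φ x) η A},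
    fun j => ?_, ?_, ?_⟩
  · have : {x | ∃ A : Finset G, A.card = j + 1 ∧ ∃ η > γ, HasGap (φ x) η A} =
        ⋃ (A : Finset G) (_ : A.card = j + 1), φ ⁻¹' {μ | ∃ η > γ, HasGap μ η A} := by
      ext x
      simp
    exact (congrArg IsOpen this).mpr
      (isOpen_biUnion fun A _ => (isOpen_exists_hasGap γ A).preimage hφ)
  · refine Set.eq_univ_of_forall fun x => ?_
    obtain ⟨j, A, hA, hgap⟩ := exists_hasGap (hsimplex x)
    refine Set.mem_iUnion.2 ⟨j, A, hA, _, ?_, hgap⟩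
    rw [hγ]
    exact one_div_lt_one_div_of_lt (by positivity) (lt_two_mul_self (by positivity))
  · intro x l hl j hmem
    have hgap : ∀ y, (∃ A : Finset G, A.card = j + 1 ∧ ∃ η > γ, HasGap (φ y) η A) →
        ∃ A : Finset G, A.card = j + 1 ∧ HasGap (φ y) γ A := by
      rintro y ⟨A, hA, η, hη, hg⟩
      exact ⟨A, hA, fun a ha b hb => by linarith [hg a ha b hb]⟩
    have hind : ∀ l : List G, (∀ s ∈ l, s ∈ E) → (∀ m : List G, m <:+ l → ∃ A : Finset G,
        A.card = j + 1 ∧ HasGap (φ (m.prod • x)) γ A) → ∃ A : Finset G,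
        A.card = j + 1 ∧ HasGap (φ x) γ A ∧ HasGap (φ (l.prod • x)) γ (l.prod • A) := by
      intro l
      induction l with
      | nil =>
        intro _ hm
        obtain ⟨A, hA, hg⟩ := hm [] (List.suffix_refl _)
        rw [List.prod_nil, one_smul] at hg
        exact ⟨A, hA, hg, by simpa using hg⟩
      | cons s l ih =>
        intro hE hm
        obtain ⟨A, hA, hg, hg'⟩ := ih (fun t ht => hE t (List.mem_cons_of_mem s ht))
          fun m hml => hm m (hml.trans (List.suffix_cons s l))
        obtain ⟨B, hB, hgB⟩ := hm (s :: l) (List.suffix_refl _)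
        refine ⟨A, hA, hg, ?_⟩
        rw [List.prod_cons, mul_smul] at hgB ⊢
        have := HasGap.eq_smul s hg' hgB (by rw [Finset.card_smul_finset, hA, hB])
          (hclose s (hE s List.mem_cons_self) _).le
        rwa [mul_smul, ← this]
    obtain ⟨A, hA, hg, hg'⟩ := hind l hl fun m hm => hgap _ (hmem m hm)
    obtain ⟨a, ha⟩ : A.Nonempty := Finset.card_pos.1 (by omega)
    refine Finset.mem_mul.2 ⟨l.prod * a, hsub _ _ hg' (Finset.smul_mem_smul_finset ha), a⁻¹,
      Finset.inv_mem_inv (hsub _ _ hg ha), by group⟩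

end AmenabilityToAsymptotic

end GroupAction

theorem mainTheorem7 (G X : Type*) [Group G] [Countable G] [MetricSpace X] [CompactSpace X]
    [MulAction G X] [ContinuousConstSMul G X]
    (hfree : ∀ (g : G) (x : X), g • x = x → g = 1)
    (hX : GroupAction.IsZeroDimensional X) :
    GroupAction.towDim G X = GroupAction.fineTowDim G X ∧
      GroupAction.fineTowDim G X = GroupAction.dynAsympDim G X ∧
      GroupAction.dynAsympDim G X = GroupAction.amDim G X := by
  have hcycle : ∀ d, (GroupAction.TowDimLE G X d ↔ GroupAction.FineTowDimLE G X d) ∧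
      (GroupAction.FineTowDimLE G X d ↔ GroupAction.DadLE G X d) ∧
      (GroupAction.DadLE G X d ↔ GroupAction.AmDimLE G X d) := by
    intro d
    have h1 : GroupAction.DadLE G X d → GroupAction.FineTowDimLE G X d :=
      GroupAction.DadLE.fineTowDimLE hX hfree
    have h2 : GroupAction.FineTowDimLE G X d → GroupAction.TowDimLE G X d :=
      GroupAction.FineTowDimLE.towDimLE
    have h3 : GroupAction.TowDimLE G X d → GroupAction.AmDimLE G X d :=
      GroupAction.TowDimLE.amDimLE hX
    have h4 : GroupAction.AmDimLE G X d → GroupAction.DadLE G X d := GroupAction.AmDimLE.dadLE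
    tauto
  exact ⟨GroupAction.leastNat_congr fun d => (hcycle d).1,
    GroupAction.leastNat_congr fun d => (hcycle d).2.1,
    GroupAction.leastNat_congr fun d => (hcycle d).2.2⟩
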